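/- Let $\mathcal A=\{a,b\}$ and let $E$ be the interchange of the letters $a$ and $b$, extended to infinite words letter by letter. For $v\in\mathcal A^*$ let $\psi(v)$ be the palindromization of $v$, defined by $\psi(\varepsilon)=\varepsilon$ and $\psi(vx)=(\psi(v)x)^{(+)}$ for $x\in\mathcal A$, where $w^{(+)}$ is the shortest palindrome having $w$ as a prefix. For an infinite word $x=x_1x_2\cdots$ let $\psi(x)=\lim_{n\to\infty}\psi(x_1\cdots x_n)$, and let $f=\psi((ab)^{\omega})$ be the Fibonacci word. A word $w\in\mathcal A^*$ is a central word of order $n$ if $w=\psi(v)$ for some $v\in\mathcal A^*$ of length $n$. Let $\pi(w)$ be the minimal period of $w$, that is, the least integer $p\ge 1$ such that any two letters of $w$ whose positions are congruent modulo $p$ are equal (so $\pi(\varepsilon)=1$). A characteristic Sturmian word is the infinite word that codes the successive cuts of a semi-line $y=\alpha x$, $x>0$, with $\alpha>0$ irrational, with the vertical lines $x=1,2,\ldots$ (coded by $a$) and the horizontal lines $y=1,2,\ldots$ (coded by $b$). **Theorem.** Let $s$ be a characteristic Sturmian word. Then the following are equivalent: 1. for every $n\ge 0$ and every palindromic prefix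 $w$ of $s$ which is a central word of order $n$, one has $\pi(u)\le\pi(w)$ for every central word $u$ of order $n$; 2. $s=f$ or $s=E(f)$. -/

import Mathlib

namespace SturmianWords

/-- The binary alphabet `{a, b}`. -/
inductive Letter : Type
  | a : Letter
  | b : Letter
  deriving DecidableEq

/-- Finite words over `{a, b}`. -/
abbrev Word : Type := List Letter

/-- Right-infinite words over `{a, b}`; the letter `x_{i+1}` of the usual notation is `x i`. -/
abbrev InfWord : Type := ℕ → Letter

/-- The interchange of the two letters. -/
def Letter.swap : Letter → Letter
  | Letter.a => Letter.b
  | Letter.b => Letter.a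

/-- The letter-interchanging map `E` on infinite words. -/
def E (x : InfWord) : InfWord := fun i => (x i).swap

/-- The prefix of length `n` of an infinite word. -/
def pre (x : InfWord) (n : ℕ) : Word := (List.range n).map x

/-- `w` is a prefix of the infinite word `x`. -/
def IsPrefixOf (w : Word) (x : InfWord) : Prop := pre x w.length = w

/-- The minimal period of a finite word: the least positive integer `p` such that `p` is a period.
It is `1` for the empty word. -/
noncomputable def minPeriod (w : Word) : ℕ := sInf {p : ℕ | 0 < p ∧ w.HasPeriod p}

theorem exists_drop_palindrome (w : Word) : ∃ k, (w.drop k).Palindrome :=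
  ⟨w.length, by rw [List.drop_length]; exact List.Palindrome.nil⟩

/-- Right palindromic closure: if `w = u Q` with `Q` the longest palindromic suffix of `w`, this is
`u Q u~`, where `u~` is the reversal of `u`. It is the shortest palindrome with prefix `w`, see
`palClosure_spec`. -/
def palClosure (w : Word) : Word :=
  w ++ (w.take (Nat.find (exists_drop_palindrome w))).reverse

theorem prefix_palClosure (w : Word) : w <+: palClosure w := List.prefix_append _ _

theorem palindrome_palClosure (w : Word) : (palClosure w).Palindrome := by
  have h := (Nat.find_spec (exists_drop_palindrome w)).reverse_eq
  apply List.Palindrome.of_reverse_eq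
  unfold palClosure
  generalize Nat.find (exists_drop_palindrome w) = k at h
  calc (w ++ (w.take k).reverse).reverse
      = w.take k ++ ((w.take k) ++ (w.drop k)).reverse := by simp
    _ = w.take k ++ ((w.drop k) ++ (w.take k).reverse) := by rw [List.reverse_append, h]
    _ = w ++ (w.take k).reverse := by rw [← List.append_assoc, List.take_append_drop]

theorem palClosure_minimal (w p : Word) (hp : p.Palindrome) (hw : w <+: p) :
    (palClosure w).length < p.length ∨ palClosure w = p := by
  obtain ⟨t, rfl⟩ := hw
  have hr : t.reverse ++ w.reverse = w ++ t := by
    rw [← List.reverse_append]; exact hp.reverse_eq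
  set k := Nat.find (exists_drop_palindrome w) with hk
  have hkw : k ≤ w.length := Nat.find_min' _ (by
    rw [List.drop_length]; exact List.Palindrome.nil)
  have hlen : (palClosure w).length = w.length + k := by
    simp [palClosure, ← hk, hkw]
  have hdrop : t.length ≤ w.length → w.take t.length = t.reverse ∧
      (w.drop t.length).Palindrome := by
    intro ht
    have h1 : w.take t.length = t.reverse := by
      have := congrArg (List.take t.length) hr
      rw [List.take_append_of_le_length ht] at this
      rw [← this, List.take_left' (by simp)]
    refine ⟨h1, List.Palindrome.of_reverse_eq ?_⟩
    have h2 : w = t.reverse ++ w.drop t.length := by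
      rw [← h1, List.take_append_drop]
    generalize w.drop t.length = d at h2 ⊢
    subst h2
    rw [List.reverse_append, List.reverse_reverse, List.append_assoc] at hr
    exact List.append_cancel_right (List.append_cancel_left hr)
  rcases lt_trichotomy t.length k with h | h | h
  · exact absurd (hdrop (by omega)).2 (Nat.find_min _ h)
  · right
    have h1 := (hdrop (by omega)).1
    unfold palClosure
    rw [← hk, ← h, h1, List.reverse_reverse]
  · left
    rw [hlen, List.length_append]; omega

/-- `palClosure w` is the unique shortest palindrome having `w` as a prefix. -/
theorem palClosure_spec (w q : Word) :
    q = palClosure w ↔ (q.Palindrome ∧ w <+: q ∧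
      ∀ p : Word, p.Palindrome → w <+: p → q.length ≤ p.length) := by
  constructor
  · rintro rfl
    refine ⟨palindrome_palClosure w, prefix_palClosure w, fun p hp hw => ?_⟩
    rcases palClosure_minimal w p hp hw with h | h
    · exact h.le
    · rw [h]
  · rintro ⟨hq, hw, hmin⟩
    rcases palClosure_minimal w q hq hw with h | h
    · have := hmin _ (palindrome_palClosure w) (prefix_palClosure w)
      omega
    · exact h.symm

/-- The palindromization map: `psi ε = ε` and `psi (v x)` is the right palindromic closure of
`(psi v) x`. -/
def psi (v : Word) : Word := v.foldl (fun w x => palClosure (w ++ [x])) []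

theorem psi_nil : psi [] = [] := rfl

theorem psi_concat (v : Word) (x : Letter) : psi (v ++ [x]) = palClosure (psi v ++ [x]) := by
  simp [psi]

theorem pre_succ (x : InfWord) (n : ℕ) : pre x (n + 1) = pre x n ++ [x n] := by
  simp [pre, List.range_succ]

theorem psi_pre_prefix_succ (x : InfWord) (n : ℕ) :
    psi (pre x n) ++ [x n] <+: psi (pre x (n + 1)) := by
  rw [pre_succ, psi_concat]; exact prefix_palClosure _

theorem le_length_psi_pre (x : InfWord) (n : ℕ) : n ≤ (psi (pre x n)).length := by
  induction n with
  | zero => simp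
  | succ n ih =>
    have h := (psi_pre_prefix_succ x n).length_le
    rw [List.length_append, List.length_singleton] at h
    omega

/-- The palindromization map on infinite words: the limit of the words `psi (x_1 ⋯ x_n)`, each of
which is a proper prefix of the next; see `psi_pre_isPrefixOf_psiInf`. -/
def psiInf (x : InfWord) : InfWord := fun n =>
  (psi (pre x (n + 1)))[n]'(le_length_psi_pre x (n + 1))

theorem psi_pre_prefix (x : InfWord) {m n : ℕ} (h : m ≤ n) : psi (pre x m) <+: psi (pre x n) := by
  induction n, h using Nat.le_induction with
  | base => exact List.prefix_rfl
  | succ n _ ih =>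
    exact ih.trans ((List.prefix_append _ _).trans (psi_pre_prefix_succ x n))

/-- `psiInf x` has every `psi (x_1 ⋯ x_n)` as a prefix. -/
theorem psi_pre_isPrefixOf_psiInf (x : InfWord) (n : ℕ) :
    IsPrefixOf (psi (pre x n)) (psiInf x) := by
  unfold IsPrefixOf
  apply List.ext_getElem
  · simp [pre]
  · intro i h1 h2
    simp only [pre, List.getElem_map, List.getElem_range]
    change (psi (pre x (i + 1)))[i]'(le_length_psi_pre x (i + 1)) = (psi (pre x n))[i]'h2
    rcases le_total n (i + 1) with h | h
    · exact ((psi_pre_prefix x h).getElem h2).symm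
    · exact (psi_pre_prefix x h).getElem _

/-- The Fibonacci word `f`, whose directive word is `(ab)^ω`. -/
def fib : InfWord := psiInf (fun i => if Even i then Letter.a else Letter.b)

/-- `s` is the sequence of the cuts made in the unit square lattice by the open semi-line
`y = α x`, `x > 0`, starting from the origin: a vertical line is coded by `a`, a horizontal one by
`b`. When the lines `x = 1, …, x = i` and `y = 1, …, y = j` have been met, the next cut is with
`x = i + 1` if the point `(i + 1, α (i + 1))` lies below the line `y = j + 1`, and with `y = j + 1`
otherwise (for `α` irrational the semi-line meets no lattice point). -/
def IsCuttingSequence (α : ℝ) (s : InfWord) : Prop :=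
  ∀ n : ℕ, s n = Letter.a ↔
    α * (((pre s n).count Letter.a : ℝ) + 1) < ((pre s n).count Letter.b : ℝ) + 1

/-- Characteristic Sturmian words: the cutting sequences of the semi-lines starting from the origin
whose slope is a positive irrational number. -/
def IsCharacteristicSturmian (s : InfWord) : Prop :=
  ∃ α : ℝ, 0 < α ∧ Irrational α ∧ IsCuttingSequence α s

/-- The central words of order `n`: those with a directive word of length `n`. -/
def IsCentralOfOrder (n : ℕ) (w : Word) : Prop := ∃ v : Word, v.length = n ∧ psi v = w

/-- `w` is a palindromic prefix of order `n` of the infinite word `s`. -/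
def IsPalPrefixOfOrder (s : InfWord) (n : ℕ) (w : Word) : Prop :=
  IsPrefixOf w s ∧ w.Palindrome ∧ IsCentralOfOrder n w

end SturmianWords

namespace SturmianWords

open List

/-! Everything rests on peeling off the first letter of a directive word: `psi (x :: v)` is `subst x
(psi v)` followed by `x` (`psi_cons`). This operation carries the longest proper border of `psi v`
to that of `psi (x :: v)`. Length minus longest border is the minimal period, so counting letters
outside the border gives a linear recursion for the period (`periodVec`, `minPeriod_psi`).

By that recursion, the period for `x :: z :: v` is at most the sum of the periods for `z :: v` and
`v`. So order `n` allows at most the Fibonacci number `Nat.fib (n + 1)`, attained by alternating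
directive words (`centralPeriod_le_fib`, `centralPeriod_eq_fib_of_alternating`). Conversely, a
maximal period passes to nonempty suffixes of the directive word, and a repeated letter followed by
two more letters loses strictly (`ne_of_centralPeriod_eq_fib`).

A characteristic Sturmian word is `psiInf` of some directive word: shears of the lattice undo the
substitutions on cutting sequences (`exists_eq_psiInf`). Maximality along all its central prefixes
forces that directive word to alternate, leaving `(ab)^ω` and `(ba)^ω`. -/

theorem Letter.swap_swap (x : Letter) : x.swap.swap = x := by cases x <;> rfl

theorem Letter.swap_ne (x : Letter) : x.swap ≠ x := by cases x <;> decide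

theorem Letter.ne_iff {x y : Letter} : x ≠ y ↔ y = x.swap := by
  cases x <;> cases y <;> decide

/-! ### The substitutions `x ↦ x`, `y ↦ xy` -/

/-- The morphism fixing the letter `x` and sending the other letter `y` to `xy`. -/
def subst (x : Letter) : Word → Word
  | [] => []
  | y :: w => if y = x then x :: subst x w else x :: y :: subst x w

theorem subst_append (x : Letter) (u v : Word) :
    subst x (u ++ v) = subst x u ++ subst x v := by
  induction u with
  | nil => rfl
  | cons y u ih => by_cases h : y = x <;> simp [subst, h, ih]

theorem subst_concat_eq_cons (x : Letter) (u : Word) : ∃ t, subst x u ++ [x] = x :: t := by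
  cases u with
  | nil => exact ⟨[], rfl⟩
  | cons y u => by_cases h : y = x <;> simp [subst, h]

theorem reverse_subst_concat (x : Letter) (u : Word) :
    (subst x u ++ [x]).reverse = subst x u.reverse ++ [x] := by
  induction u with
  | nil => rfl
  | cons y u ih =>
    rw [reverse_cons, subst_append]
    by_cases h : y = x
    · simp only [subst, h, if_true, cons_append, reverse_cons, ih]
    · simp only [subst, h, if_false, cons_append, reverse_cons, ih]
      simp

/-- Every block starts with `x`, so the trailing `x` acts as the start of a next block and makes the
decoding unambiguous. Without it the equivalence fails: for `y ≠ x`, the image `x` of `x` is a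
prefix of the image `xy` of `y`. -/
theorem subst_concat_prefix_iff {x : Letter} {u v : Word} :
    subst x u ++ [x] <+: subst x v ++ [x] ↔ u <+: v := by
  constructor
  · induction u generalizing v with
    | nil => exact fun _ => nil_prefix
    | cons y u ih =>
      intro h
      cases v with
      | nil =>
        have := h.length_le
        by_cases hy : y = x <;> simp [subst, hy] at this
      | cons z v =>
        obtain ⟨t, ht⟩ := subst_concat_eq_cons x u
        obtain ⟨t', ht'⟩ := subst_concat_eq_cons x v
        by_cases hy : y = x <;> by_cases hz : z = x
        · subst hy hz
          simp only [subst, if_true, cons_append, cons_prefix_cons, true_and] at h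
          simpa using ih h
        · subst hy
          simp only [subst, if_true, hz, if_false, cons_append, cons_prefix_cons, true_and,
            ht] at h
          exact absurd h.1.symm hz
        · subst hz
          simp only [subst, if_true, hy, if_false, cons_append, cons_prefix_cons, true_and,
            ht'] at h
          exact h.1.elim
        · simp only [subst, hy, hz, if_false, cons_append, cons_prefix_cons, true_and] at h
          rw [cons_prefix_cons]
          exact ⟨h.1, ih h.2⟩
  · rintro ⟨t, rfl⟩
    obtain ⟨t', ht'⟩ := subst_concat_eq_cons x t
    rw [subst_append, append_assoc, prefix_append_right_inj, ht']
    simp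

theorem subst_concat_injective {x : Letter} {u v : Word}
    (h : subst x u ++ [x] = subst x v ++ [x]) : u = v := by
  have h1 : u <+: v := subst_concat_prefix_iff.1 (by rw [h])
  have h2 : v <+: u := subst_concat_prefix_iff.1 (by rw [h])
  exact h1.eq_of_length (le_antisymm h1.length_le h2.length_le)

theorem subst_concat_palindrome_iff {x : Letter} {u : Word} :
    (subst x u ++ [x]).Palindrome ↔ u.Palindrome := by
  rw [Palindrome.iff_reverse_eq, Palindrome.iff_reverse_eq, reverse_subst_concat]
  exact ⟨subst_concat_injective, fun h => by rw [h]⟩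

/-- Suffixes of `subst x u ++ [x]` starting with `x` start at a block boundary. -/
theorem exists_of_append_cons_eq_subst {x : Letter} {u t r : Word}
    (h : t ++ x :: r = subst x u ++ [x]) :
    ∃ u₁ u₂, u = u₁ ++ u₂ ∧ t = subst x u₁ ∧ x :: r = subst x u₂ ++ [x] := by
  induction u generalizing t with
  | nil =>
    cases t with
    | nil => exact ⟨[], [], rfl, rfl, h⟩
    | cons c t => simp [subst] at h
  | cons y u ih =>
    cases t with
    | nil => exact ⟨[], y :: u, rfl, rfl, h⟩
    | cons c t =>
      by_cases hy : y = x
      · simp only [subst, hy, if_true, cons_append, cons.injEq] at h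
        obtain ⟨u₁, u₂, rfl, rfl, h3⟩ := ih h.2
        exact ⟨y :: u₁, u₂, rfl, by simp [subst, hy, h.1], h3⟩
      · simp only [subst, hy, if_false, cons_append, cons.injEq] at h
        cases t with
        | nil =>
          simp only [nil_append, cons.injEq] at h
          exact absurd h.2.1.symm hy
        | cons d t =>
          simp only [cons_append, cons.injEq] at h
          obtain ⟨u₁, u₂, rfl, rfl, h3⟩ := ih h.2.2
          exact ⟨y :: u₁, u₂, rfl, by simp [subst, hy, h.1, h.2.1], h3⟩

/-- In `subst x u` every letter other than `x` is preceded by `x`. -/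
theorem exists_concat_of_append_cons_eq_subst {x y : Letter} (hxy : y ≠ x) {u t r : Word}
    (h : t ++ y :: r = subst x u) : ∃ t', t = t' ++ [x] := by
  induction u generalizing t with
  | nil => simp [subst] at h
  | cons z u ih =>
    cases t with
    | nil => by_cases hz : z = x <;> simp [subst, hz, hxy] at h
    | cons c t =>
      by_cases hz : z = x
      · simp only [subst, hz, if_true, cons_append, cons.injEq] at h
        obtain ⟨t', rfl⟩ := ih h.2
        exact ⟨c :: t', rfl⟩
      · simp only [subst, hz, if_false, cons_append, cons.injEq] at h
        cases t with
        | nil => exact ⟨[], by simp [h.1]⟩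
        | cons d t =>
          simp only [cons_append, cons.injEq] at h
          obtain ⟨t', rfl⟩ := ih h.2.2
          exact ⟨c :: d :: t', rfl⟩

theorem length_eq_count_add_count (w : Word) (x : Letter) :
    w.length = w.count x + w.count x.swap := by
  induction w with
  | nil => rfl
  | cons y w ih => cases x <;> cases y <;> simp [Letter.swap] at * <;> omega

theorem count_subst_self (x : Letter) (w : Word) : (subst x w).count x = w.length := by
  induction w with
  | nil => rfl
  | cons y w ih => by_cases h : y = x <;> simp [subst, h, ih]

theorem count_subst_of_ne {x y : Letter} (hxy : y ≠ x) (w : Word) :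
    (subst x w).count y = w.count y := by
  induction w with
  | nil => rfl
  | cons z w ih =>
    by_cases h : z = x <;> simp [subst, h, ih, count_cons, hxy.symm]

theorem length_subst (x : Letter) (w : Word) :
    (subst x w).length = w.length + w.count x.swap := by
  rw [length_eq_count_add_count _ x, count_subst_self, count_subst_of_ne (Letter.swap_ne x)]

theorem map_swap_subst (x : Letter) (w : Word) :
    (subst x w).map Letter.swap = subst x.swap (w.map Letter.swap) := by
  induction w with
  | nil => rfl
  | cons y w ih => cases x <;> cases y <;> simp [subst, Letter.swap] <;> exact ih

/-! ### Palindromic closure and the palindromization map -/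

theorem exists_palClosure_eq (w : Word) : ∃ t r : Word, w = t ++ r ∧ r.Palindrome ∧
    (∀ t' r' : Word, w = t' ++ r' → r'.Palindrome → t.length ≤ t'.length) ∧
    palClosure w = w ++ t.reverse := by
  refine ⟨_, _, (take_append_drop (Nat.find (exists_drop_palindrome w)) w).symm,
    Nat.find_spec (exists_drop_palindrome w), ?_, rfl⟩
  rintro t' r' h hr'
  refine (length_take_le _ _).trans (Nat.find_min' _ ?_)
  rw [h, drop_left]
  exact hr'

theorem palClosure_eq {w t r : Word} (h : w = t ++ r) (hr : r.Palindrome)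
    (hmin : ∀ t' r' : Word, w = t' ++ r' → r'.Palindrome → t.length ≤ t'.length) :
    palClosure w = w ++ t.reverse := by
  obtain ⟨t₁, r₁, h₁, hr₁, hmin₁, he⟩ := exists_palClosure_eq w
  have hl : t₁.length = t.length := le_antisymm (hmin₁ t r h hr) (hmin t₁ r₁ h₁ hr₁)
  rw [he, (append_inj (h₁.symm.trans h) hl).1]

theorem palindrome_starts_of_ends {r s : Word} {x : Letter} (hr : r.Palindrome) (hne : r ≠ [])
    {t : Word} (h : t ++ r = s ++ [x]) : ∃ r', r = x :: r' := by
  obtain ⟨r₀, c, rfl⟩ := (eq_nil_or_concat' r).resolve_left hne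
  rw [← append_assoc] at h
  have hc : c = x := by simpa using (append_inj' h rfl).2
  subst hc
  have := hr.reverse_eq
  rw [reverse_append] at this
  exact ⟨_, this.symm⟩

/-- A nonempty palindromic suffix ends, hence begins, with `x`, so it starts at a block boundary and
decodes to a palindromic suffix of `u`. The longest ones therefore correspond. -/
theorem palClosure_subst_concat (x : Letter) (u : Word) :
    palClosure (subst x u ++ [x]) = subst x (palClosure u) ++ [x] := by
  obtain ⟨t, r, hu, hr, hmin, he⟩ := exists_palClosure_eq u
  have hcl : palClosure (subst x u ++ [x]) = (subst x u ++ [x]) ++ (subst x t).reverse := by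
    refine palClosure_eq (r := subst x r ++ [x]) ?_ (subst_concat_palindrome_iff.2 hr) ?_
    · rw [hu, subst_append, append_assoc]
    · intro t' r' h hr'
      by_cases hne : r' = []
      · subst hne
        have := congrArg length h
        rw [hu, subst_append] at this
        simp at this
        omega
      · obtain ⟨r₁, rfl⟩ := palindrome_starts_of_ends hr' hne h.symm
        obtain ⟨u₁, u₂, hu', rfl, h3⟩ := exists_of_append_cons_eq_subst h.symm
        rw [h3, subst_concat_palindrome_iff] at hr'
        have hle := hmin u₁ u₂ hu' hr'
        obtain ⟨s, rfl⟩ : t <+: u₁ :=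
          prefix_of_prefix_length_le (hu ▸ prefix_append _ _) (hu' ▸ prefix_append _ _) hle
        rw [subst_append, length_append]
        omega
  have hrev := reverse_subst_concat x t
  rw [reverse_append] at hrev
  rw [hcl, he, subst_append, append_assoc, append_assoc, ← hrev]
  rfl

/-- Every `y` is preceded by `x`, so a nonempty palindromic suffix `q` of the shorter word extends
to the palindromic suffix `x q x` of the longer one. Longest suffixes match, and the added `x` is
already the next letter of the closure. -/
theorem palClosure_subst_of_ne {x y : Letter} (hxy : y ≠ x) (w : Word) :
    palClosure (subst x (w ++ [y]) ++ [x]) = palClosure (subst x (w ++ [y])) := by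
  obtain ⟨t, r, h, hr, hmin, he⟩ := exists_palClosure_eq (subst x (w ++ [y]) ++ [x])
  have hw : subst x (w ++ [y]) = (subst x w ++ [x]) ++ [y] := by
    simp [subst_append, subst, hxy]
  have hne : r ≠ [] := by
    rintro rfl
    have h1 := hmin _ [x] rfl (Palindrome.singleton x)
    have := congrArg length h
    simp at this h1
    omega
  obtain ⟨r₁, hr₁⟩ := palindrome_starts_of_ends hr hne h.symm
  subst hr₁
  cases hr with
  | singleton =>
    -- a longer palindromic suffix is `x y x`
    have h2 := hmin (subst x w) [x, y, x] (by simp [hw])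
      (Palindrome.of_reverse_eq (by simp))
    have := congrArg length h
    simp [hw] at this
    omega
  | cons_concat _ hp =>
    rename_i q
    have hY : subst x (w ++ [y]) = (t ++ [x]) ++ q := by
      have : subst x (w ++ [y]) ++ [x] = ((t ++ [x]) ++ q) ++ [x] := by
        rw [h]; simp
      exact append_cancel_right this
    rw [he, palClosure_eq hY hp]
    · simp
    · intro t' r' h' hr'
      by_cases hne' : r' = []
      · subst hne'
        have := congrArg length (h'.symm.trans hY)
        simp at this ⊢
        omega
      · obtain ⟨r₂, rfl⟩ := palindrome_starts_of_ends hr' hne' (h'.symm.trans hw)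
        obtain ⟨t₀, rfl⟩ := exists_concat_of_append_cons_eq_subst hxy h'.symm
        have := hmin t₀ (x :: ((y :: r₂) ++ [x])) (by rw [h']; simp)
          (Palindrome.cons_concat x hr')
        simpa using this

theorem palClosure_singleton (x : Letter) : palClosure [x] = [x] := by
  simpa using palClosure_eq (w := [x]) (t := []) (r := [x]) rfl (Palindrome.singleton x) (by simp)

/-- Justin's formula for a one-letter prefix of the directive word. -/
theorem psi_cons (x : Letter) (v : Word) : psi (x :: v) = subst x (psi v) ++ [x] := by
  induction v using List.reverseRecOn with
  | nil =>
    have := psi_concat [] x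
    simpa [psi_nil, subst, palClosure_singleton] using this
  | append_singleton v y ih =>
    rw [← cons_append, psi_concat, psi_concat, ih, ← palClosure_subst_concat]
    by_cases hy : y = x
    · simp [hy, subst_append, subst]
    · rw [palClosure_subst_of_ne hy]
      simp [hy, subst_append, subst]

theorem psi_map_swap (v : Word) : psi (v.map Letter.swap) = (psi v).map Letter.swap := by
  induction v with
  | nil => rfl
  | cons x v ih => simp [psi_cons, ih, map_swap_subst]

/-! ### Borders and minimal periods -/

/-- `z` is the longest proper border of `w`. -/
def IsLongestBorder (z w : Word) : Prop :=
  (z <+: w ∧ z <:+ w ∧ z.length < w.length) ∧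
    ∀ y : Word, y <+: w → y <:+ w → y.length < w.length → y.length ≤ z.length

theorem hasPeriod_iff_drop_prefix {w : Word} {p : ℕ} : w.HasPeriod p ↔ w.drop p <+: w := by
  have : w.HasPeriod p ↔ w.take p ++ w.drop p <+: w.take p ++ w := by
    rw [take_append_drop]; rfl
  rw [this, prefix_append_right_inj]

/-- Dropping the first `p` letters yields a border exactly when `p` is a period, so the least period
leaves the longest border. -/
theorem IsLongestBorder.minPeriod_add_length {z w : Word} (h : IsLongestBorder z w) :
    minPeriod w + z.length = w.length := by
  obtain ⟨⟨h1, h2, h3⟩, h4⟩ := h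
  have hdrop : w.drop (w.length - z.length) = z := (suffix_iff_eq_drop.1 h2).symm
  have hmem : w.length - z.length ∈ {p : ℕ | 0 < p ∧ w.HasPeriod p} :=
    ⟨by omega, by rw [hasPeriod_iff_drop_prefix, hdrop]; exact h1⟩
  have hle : minPeriod w ≤ w.length - z.length := Nat.sInf_le hmem
  obtain ⟨hp, hper⟩ : minPeriod w ∈ {p : ℕ | 0 < p ∧ w.HasPeriod p} := Nat.sInf_mem ⟨_, hmem⟩
  have := h4 (w.drop (minPeriod w)) (hasPeriod_iff_drop_prefix.1 hper) (drop_suffix _ _)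
    (by rw [length_drop]; omega)
  rw [length_drop] at this
  omega

/-- A nonempty border of the image starts with `x`, hence at a block boundary, and decodes to a
border of `w`. -/
theorem IsLongestBorder.subst {z w : Word} (x : Letter) (h : IsLongestBorder z w) :
    IsLongestBorder (subst x z ++ [x]) (subst x w ++ [x]) := by
  obtain ⟨⟨h1, h2, h3⟩, h4⟩ := h
  have hmono : ∀ {u v : Word}, u <+: v → (SturmianWords.subst x u).length ≤
      (SturmianWords.subst x v).length := by
    rintro u _ ⟨t, rfl⟩
    rw [subst_append, length_append]
    omega
  refine ⟨⟨subst_concat_prefix_iff.2 h1, ?_, ?_⟩, ?_⟩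
  · obtain ⟨t, rfl⟩ := h2
    rw [subst_append, append_assoc]
    exact suffix_append _ _
  · obtain ⟨t, rfl⟩ := h1
    have : t ≠ [] := by rintro rfl; simp at h3
    have ht := length_pos_iff.2 this
    rw [subst_append]
    simp only [length_append, length_subst]
    omega
  · rintro y hy1 ⟨t, ht⟩ hy3
    cases y with
    | nil => simp
    | cons c y =>
      obtain ⟨s, hs⟩ := subst_concat_eq_cons x w
      have hc : c = x := by rw [hs, cons_prefix_cons] at hy1; exact hy1.1
      subst hc
      obtain ⟨u₁, u₂, rfl, rfl, h7⟩ := exists_of_append_cons_eq_subst ht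
      rw [h7] at hy1 hy3 ⊢
      have hpre := subst_concat_prefix_iff.1 hy1
      have hlt : u₂.length < (u₁ ++ u₂).length := by
        rcases hpre.length_le.lt_or_eq with h | h
        · exact h
        · rw [← hpre.eq_of_length h] at hy3
          exact absurd hy3 (lt_irrefl _)
      have hle := h4 u₂ hpre (suffix_append _ _) hlt
      have := hmono (prefix_of_prefix_length_le hpre h1 hle)
      simpa using this

/-- The numbers of occurrences of the letters in the period word of `psi v`, for `v ≠ []`. -/
def periodVec : Word → Letter → ℕ
  | [], _ => 0
  | [x], y => if y = x then 1 else 0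
  | x :: z :: v, y =>
    if y = x then periodVec (z :: v) x + periodVec (z :: v) x.swap else periodVec (z :: v) y

/-- The minimal period of `psi v`, see `minPeriod_psi`. -/
def centralPeriod (v : Word) : ℕ :=
  if v = [] then 1 else periodVec v Letter.a + periodVec v Letter.b

theorem centralPeriod_eq {v : Word} (hv : v ≠ []) (x : Letter) :
    centralPeriod v = periodVec v x + periodVec v x.swap := by
  cases x
  · simp [centralPeriod, hv, Letter.swap]
  · simp [centralPeriod, hv, Letter.swap, add_comm]

theorem exists_isLongestBorder_psi {v : Word} (hv : v ≠ []) :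
    ∃ z, IsLongestBorder z (psi v) ∧
      ∀ y, (psi v).count y = z.count y + periodVec v y := by
  induction v with
  | nil => exact absurd rfl hv
  | cons x v ih =>
    cases v with
    | nil =>
      refine ⟨[], ⟨⟨nil_prefix, nil_suffix, ?_⟩, ?_⟩, ?_⟩
      · simp [psi_cons]
      · intro y _ _ h
        simpa [psi_cons, subst, psi_nil] using h
      · intro y
        rw [psi_cons, psi_nil]
        by_cases h : y = x
        · simp [subst, periodVec, h]
        · simp [subst, periodVec, h, Ne.symm h]
    | cons t v =>
      obtain ⟨z, hz, hcount⟩ := ih (by simp)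
      refine ⟨subst x z ++ [x], by rw [psi_cons]; exact hz.subst x, fun y => ?_⟩
      rw [psi_cons, count_append, count_append]
      by_cases h : y = x
      · subst h
        -- Each block contains exactly one `x`, so the new count of `x` outside the border is the
        -- old total length outside it, while the other letter keeps its count.
        rw [count_subst_self, count_subst_self, length_eq_count_add_count _ y,
          length_eq_count_add_count z y, hcount, hcount]
        simp only [periodVec, if_true]
        omega
      · rw [count_subst_of_ne h, count_subst_of_ne h, hcount]
        simp only [periodVec, h, if_false]
        omega

theorem minPeriod_psi (v : Word) : minPeriod (psi v) = centralPeriod v := by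
  by_cases hv : v = []
  · subst hv
    have h1 : (1 : ℕ) ∈ {p : ℕ | 0 < p ∧ (psi []).HasPeriod p} :=
      ⟨one_pos, by simp [psi_nil]⟩
    have h2 : minPeriod (psi []) ≤ 1 := Nat.sInf_le h1
    have h3 : 0 < minPeriod (psi []) := (Nat.sInf_mem ⟨_, h1⟩).1
    simp only [centralPeriod, if_true]
    omega
  · obtain ⟨z, hz, hcount⟩ := exists_isLongestBorder_psi hv
    have := hz.minPeriod_add_length
    rw [length_eq_count_add_count (psi v) Letter.a, length_eq_count_add_count z Letter.a,
      hcount, hcount] at this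
    rw [centralPeriod_eq hv Letter.a]
    omega

/-! ### Maximal values of the period -/

theorem centralPeriod_cons {v : Word} (hv : v ≠ []) (x : Letter) :
    centralPeriod (x :: v) = centralPeriod v + periodVec v x.swap := by
  obtain ⟨z, v, rfl⟩ := exists_cons_of_ne_nil hv
  rw [centralPeriod_eq (by simp) x, centralPeriod_eq (by simp) x]
  simp [periodVec, Letter.swap_ne]

/-- The convention that the empty word has period `1` makes this hold for `v = []` too. -/
theorem periodVec_cons_self (x : Letter) (v : Word) :
    periodVec (x :: v) x = centralPeriod v := by
  cases v with
  | nil => simp [periodVec, centralPeriod]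
  | cons z v => rw [centralPeriod_eq (by simp) x]; simp [periodVec]

theorem periodVec_cons_of_ne {x y : Letter} (h : y ≠ x) (v : Word) :
    periodVec (x :: v) y = periodVec v y := by
  cases v <;> simp [periodVec, h]

theorem periodVec_le_centralPeriod (v : Word) (y : Letter) :
    periodVec v y ≤ centralPeriod v := by
  by_cases hv : v = []
  · subst hv; simp [periodVec]
  · rw [centralPeriod_eq hv y]; omega

theorem periodVec_cons_le (x y : Letter) (v : Word) :
    periodVec (x :: v) y ≤ centralPeriod v := by
  by_cases h : y = x
  · rw [h, periodVec_cons_self]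
  · rw [periodVec_cons_of_ne h]; exact periodVec_le_centralPeriod v y

/-- The recursion reaches two letters back, so two consecutive lengths are carried through the
induction. -/
theorem centralPeriod_le_fib (v : Word) :
    centralPeriod v ≤ Nat.fib (v.length + 1) ∧
      ∀ x, centralPeriod (x :: v) ≤ Nat.fib (v.length + 2) := by
  induction v with
  | nil => exact ⟨by simp [centralPeriod], fun x => by cases x <;> simp [centralPeriod, periodVec]⟩
  | cons z v ih =>
    refine ⟨ih.2 z, fun x => ?_⟩
    rw [centralPeriod_cons (by simp), length_cons, Nat.fib_add_two,
      show v.length + 1 + 1 = v.length + 2 from rfl]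
    have h1 := ih.2 z
    have h2 := (periodVec_cons_le z x.swap v).trans ih.1
    omega

theorem periodVec_le_fib {v : Word} (hv : v ≠ []) (y : Letter) :
    periodVec v y ≤ Nat.fib v.length := by
  obtain ⟨z, v, rfl⟩ := exists_cons_of_ne_nil hv
  exact (periodVec_cons_le z y v).trans (centralPeriod_le_fib v).1

theorem centralPeriod_eq_fib_of_alternating (v : Word)
    (hv : v.IsChain (· ≠ ·)) : centralPeriod v = Nat.fib (v.length + 1) := by
  induction h : v.length using Nat.strong_induction_on generalizing v with
  | _ n ih =>
    subst h
    match v, hv, ih with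
    | [], _, _ => simp [centralPeriod]
    | [x], _, _ => cases x <;> simp [centralPeriod, periodVec]
    | x :: z :: v, hv, ih =>
      rw [isChain_cons_cons] at hv
      have hz : z = x.swap := Letter.ne_iff.1 hv.1
      rw [centralPeriod_cons (by simp), ← hz, periodVec_cons_self,
        ih _ (by simp) (z :: v) hv.2 rfl, ih _ (by simp) v hv.2.of_cons rfl]
      simp only [length_cons]
      rw [Nat.fib_add_two (n := v.length + 1)]
      omega

/-- Both summands of the recursion are bounded by the matching summands of the Fibonacci recursion,
so equality of the sums forces equality in each. -/
theorem centralPeriod_eq_fib_of_append {u v : Word} (hv : v ≠ [])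
    (h : centralPeriod (u ++ v) = Nat.fib ((u ++ v).length + 1)) :
    centralPeriod v = Nat.fib (v.length + 1) := by
  induction u with
  | nil => exact h
  | cons x u ih =>
    apply ih
    have hne : u ++ v ≠ [] := by simp [hv]
    rw [cons_append, centralPeriod_cons hne, length_cons, Nat.fib_add_two] at h
    have h1 := (centralPeriod_le_fib (u ++ v)).1
    have h2 := periodVec_le_fib hne x.swap
    omega

/-- For `xxv` with `|v| = 2` the period is at most `2 + 2 * 1 = 4`, below the maximum `5`. Two
further letters are needed: `aab` attains the maximum `3` for length three. -/
theorem ne_of_centralPeriod_eq_fib {u v : Word} {x z : Letter} (hv : v.length = 2)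
    (h : centralPeriod (u ++ x :: z :: v) = Nat.fib ((u ++ x :: z :: v).length + 1)) :
    x ≠ z := by
  have h' := centralPeriod_eq_fib_of_append (by simp) h
  rintro rfl
  have hne : v ≠ [] := by rintro rfl; simp at hv
  rw [centralPeriod_cons (by simp), centralPeriod_cons hne,
    periodVec_cons_of_ne (Letter.swap_ne x)] at h'
  have h1 := (centralPeriod_le_fib v).1
  have h2 := periodVec_le_fib hne x.swap
  simp only [length_cons, hv] at h' h1 h2
  norm_num [Nat.fib_add_two] at h' h1 h2
  omega

/-! ### Infinite words -/

theorem length_pre (x : InfWord) (n : ℕ) : (pre x n).length = n := by simp [pre]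

theorem pre_add (x : InfWord) (m n : ℕ) : pre x (m + n) = pre x m ++ pre (fun i => x (m + i)) n := by
  simp [pre, range_add]

theorem pre_prefix (x : InfWord) {m n : ℕ} (h : m ≤ n) : pre x m <+: pre x n := by
  obtain ⟨k, rfl⟩ := Nat.exists_eq_add_of_le h
  rw [pre_add]
  exact prefix_append _ _

theorem isPrefixOf_iff {w : Word} {x : InfWord} : IsPrefixOf w x ↔ ∃ n, w <+: pre x n := by
  constructor
  · intro h
    exact ⟨w.length, by rw [show pre x w.length = w from h]⟩
  · rintro ⟨n, h⟩
    have hn : w.length ≤ n := by simpa [length_pre] using h.length_le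
    exact (prefix_of_prefix_length_le (pre_prefix x hn) h (by rw [length_pre])).eq_of_length
      (length_pre _ _)

theorem IsPrefixOf.of_prefix {u w : Word} {x : InfWord} (hw : IsPrefixOf w x) (h : u <+: w) :
    IsPrefixOf u x :=
  isPrefixOf_iff.2 ⟨w.length, by rw [show pre x w.length = w from hw]; exact h⟩

theorem IsPrefixOf.eq_of_length {u w : Word} {x : InfWord} (hu : IsPrefixOf u x)
    (hw : IsPrefixOf w x) (h : u.length = w.length) : u = w := by
  rw [← show pre x u.length = u from hu, h]
  exact hw

theorem isPrefixOf_concat {w : Word} {s : InfWord} (h : IsPrefixOf w s) :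
    IsPrefixOf (w ++ [s w.length]) s := by
  unfold IsPrefixOf
  rw [length_append, length_singleton, pre_succ, show pre s w.length = w from h]

/-- The directive word is determined by the prefixes `psi v` of `psiInf x`. -/
theorem eq_pre_of_isPrefixOf_psiInf {x : InfWord} {v : Word}
    (h : IsPrefixOf (psi v) (psiInf x)) : v = pre x v.length := by
  induction v using List.reverseRecOn with
  | nil => rfl
  | append_singleton v y ih =>
    have h1 : psi v ++ [y] <+: psi (v ++ [y]) := by
      rw [psi_concat]; exact prefix_palClosure _
    have hv := ih (h.of_prefix ((prefix_append _ _).trans h1))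
    -- The letter following `psi v` in the infinite word is the next directive letter, so it can be
    -- read off.
    have h2 : IsPrefixOf (psi (pre x v.length) ++ [x v.length]) (psiInf x) :=
      (psi_pre_isPrefixOf_psiInf x _).of_prefix (psi_pre_prefix_succ x _)
    rw [← hv] at h2
    have h3 := (h.of_prefix h1).eq_of_length h2 (by simp)
    have hy : y = x v.length := by simpa using h3
    rw [length_append, length_singleton, pre_succ, ← hv, ← hy]

theorem eq_psiInf {s x : InfWord} (h : ∀ n, IsPrefixOf (psi (pre x n)) s) : s = psiInf x := by
  funext i
  have h1 : pre s (psi (pre x (i + 1))).length = pre (psiInf x) (psi (pre x (i + 1))).length :=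
    (h (i + 1)).trans (psi_pre_isPrefixOf_psiInf x (i + 1)).symm
  have hi := le_length_psi_pre x (i + 1)
  have h2 := congrArg (fun w : Word => w[i]?) h1
  generalize (psi (pre x (i + 1))).length = m at hi h2
  simpa [pre, getElem?_range (show i < m by omega)] using h2

theorem pre_E (x : InfWord) (n : ℕ) : pre (E x) n = (pre x n).map Letter.swap := by
  simp [pre, E, Function.comp_def]

theorem E_psiInf (x : InfWord) : E (psiInf x) = psiInf (E x) := by
  refine eq_psiInf fun n => ?_
  unfold IsPrefixOf
  rw [pre_E, pre_E, psi_map_swap, length_map]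
  exact congrArg _ (psi_pre_isPrefixOf_psiInf x n)

/-! ### Cutting sequences -/

/-- The semi-line meets the unit cell whose lower left corner is given by the two counts. -/
theorem IsCuttingSequence.invariants {α : ℝ} {s : InfWord} (h0 : 0 < α)
    (hs : IsCuttingSequence α s) (n : ℕ) :
    α * (pre s n).count Letter.a < (pre s n).count Letter.b + 1 ∧
      ((pre s n).count Letter.b : ℝ) ≤ α * ((pre s n).count Letter.a + 1) := by
  induction n with
  | zero => simp [pre, h0.le]
  | succ n ih =>
    rw [pre_succ]
    have := hs n
    cases hn : s n
    · have h := this.1 hn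
      simp only [count_append, count_singleton]
      push_cast
      constructor
      · simpa using h
      · simp; nlinarith [ih.2]
    · have h : ¬ _ := fun h => by simpa [hn] using this.2 h
      simp only [count_append, count_singleton]
      push_cast
      constructor
      · simp; linarith [ih.1]
      · simp; linarith [not_lt.1 h]

/-- The word coding the cuts is built letter by letter. -/
noncomputable def cuttingPrefix (α : ℝ) : ℕ → Word
  | 0 => []
  | n + 1 => cuttingPrefix α n ++
      [open Classical in if α * (((cuttingPrefix α n).count Letter.a : ℝ) + 1) <
        ((cuttingPrefix α n).count Letter.b : ℝ) + 1 then Letter.a else Letter.b]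

theorem exists_isCuttingSequence (α : ℝ) : ∃ s, IsCuttingSequence α s := by
  classical
  let s : InfWord := fun n => if α * (((cuttingPrefix α n).count Letter.a : ℝ) + 1) <
        ((cuttingPrefix α n).count Letter.b : ℝ) + 1 then Letter.a else Letter.b
  have hs : ∀ n, pre s n = cuttingPrefix α n := by
    intro n
    induction n with
    | zero => rfl
    | succ n ih => rw [pre_succ, ih]; simp only [cuttingPrefix, s]
  refine ⟨s, fun n => ?_⟩
  rw [hs]
  by_cases h : α * (((cuttingPrefix α n).count Letter.a : ℝ) + 1) <
      ((cuttingPrefix α n).count Letter.b : ℝ) + 1 <;> simp [s, h]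

theorem IsCuttingSequence.concat_a {α : ℝ} {s : InfWord} (hs : IsCuttingSequence α s) {w : Word}
    (hw : IsPrefixOf w s)
    (h : α * ((w.count Letter.a : ℝ) + 1) < (w.count Letter.b : ℝ) + 1) :
    IsPrefixOf (w ++ [Letter.a]) s := by
  have h1 := hs w.length
  rw [show pre s w.length = w from hw] at h1
  rw [← h1.2 h]
  exact isPrefixOf_concat hw

theorem IsCuttingSequence.concat_b {α : ℝ} {s : InfWord} (hs : IsCuttingSequence α s) {w : Word}
    (hw : IsPrefixOf w s)
    (h : (w.count Letter.b : ℝ) + 1 ≤ α * ((w.count Letter.a : ℝ) + 1)) :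
    IsPrefixOf (w ++ [Letter.b]) s := by
  have h1 := hs w.length
  rw [show pre s w.length = w from hw] at h1
  have h2 : s w.length = Letter.b := by
    cases hl : s w.length
    · exact absurd (h1.1 hl) (not_lt.2 h)
    · rfl
  rw [← h2]
  exact isPrefixOf_concat hw

/-- On letter counts the substitution acts as the shear `(i, j) ↦ (i + j, j)`, which sends slope `β`
to `β / (1 + β) = α`. -/
theorem IsCuttingSequence.desubst_of_lt_one {α β : ℝ} (h0 : 0 < α) (h1 : α < 1)
    (hβ : β * (1 - α) = α) {s t : InfWord} (hs : IsCuttingSequence α s)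
    (ht : IsCuttingSequence β t) (n : ℕ) :
    IsPrefixOf (subst Letter.a (pre t n) ++ [Letter.a]) s := by
  have hβ0 : 0 < β := pos_of_mul_pos_left (by rw [hβ]; exact h0) (by linarith)
  induction n with
  | zero => exact hs.concat_a (w := []) rfl (by simpa using h1)
  | succ n ih =>
    obtain ⟨hi, -⟩ := ht.invariants hβ0 n
    have hca : (subst Letter.a (pre t n) ++ [Letter.a]).count Letter.a =
        (pre t n).count Letter.a + (pre t n).count Letter.b + 1 := by
      rw [count_append, count_subst_self, length_eq_count_add_count _ Letter.a]
      simp [Letter.swap]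
    have hcb : (subst Letter.a (pre t n) ++ [Letter.a]).count Letter.b =
        (pre t n).count Letter.b := by
      rw [count_append, count_subst_of_ne (by decide)]
      simp
    have hn := ht n
    rw [pre_succ]
    generalize pre t n = w at *
    have hpos : 0 < 1 - α := by linarith
    cases hl : t n
    · have h2 := mul_lt_mul_of_pos_right (hn.1 hl) hpos
      have h3 := hs.concat_a ih (by
        rw [hca, hcb]; push_cast
        linear_combination h2 + ((w.count Letter.a : ℝ) + 1) * (-hβ))
      simpa [subst_append, subst] using h3
    · have h2 : ¬ _ := fun h => by simpa [hl] using hn.2 h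
      have h2' := mul_le_mul_of_nonneg_right (not_lt.1 h2) hpos.le
      have h3 := hs.concat_b ih (by
        rw [hca, hcb]; push_cast
        linear_combination h2' + ((w.count Letter.a : ℝ) + 1) * hβ)
      -- As `α < 1`, no two consecutive letters are `b`; the cell invariant for `t` gives the
      -- inequality.
      have h4 := hs.concat_a h3 (by
        rw [count_append (l₁ := _ ++ _), count_append (l₁ := _ ++ _), hca, hcb]
        have h5 := mul_lt_mul_of_pos_right hi hpos
        simp
        linear_combination h5 + h1 + (w.count Letter.a : ℝ) * (-hβ))
      simpa [subst_append, subst] using h4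

/-- Here the shear is `(i, j) ↦ (i, i + j)`, which raises the slope by one. -/
theorem IsCuttingSequence.desubst_of_one_lt {α : ℝ} (h1 : 1 < α) {s t : InfWord}
    (hs : IsCuttingSequence α s) (ht : IsCuttingSequence (α - 1) t) (n : ℕ) :
    IsPrefixOf (subst Letter.b (pre t n) ++ [Letter.b]) s := by
  induction n with
  | zero => exact hs.concat_b (w := []) rfl (by simpa using h1.le)
  | succ n ih =>
    obtain ⟨-, hi⟩ := ht.invariants (by linarith) n
    have hcb : (subst Letter.b (pre t n) ++ [Letter.b]).count Letter.b =
        (pre t n).count Letter.a + (pre t n).count Letter.b + 1 := by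
      rw [count_append, count_subst_self, length_eq_count_add_count _ Letter.a]
      simp [Letter.swap]
    have hca : (subst Letter.b (pre t n) ++ [Letter.b]).count Letter.a =
        (pre t n).count Letter.a := by
      rw [count_append, count_subst_of_ne (by decide)]
      simp
    have hn := ht n
    rw [pre_succ]
    generalize pre t n = w at *
    cases hl : t n
    · have h2 := hn.1 hl
      have h3 := hs.concat_a ih (by
        rw [hca, hcb]; push_cast
        linarith)
      have h4 := hs.concat_b h3 (by
        rw [count_append (l₁ := _ ++ _), count_append (l₁ := _ ++ _), hca, hcb]
        simp
        linarith)
      simpa [subst_append, subst] using h4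
    · have h2 : ¬ _ := fun h => by simpa [hl] using hn.2 h
      have h3 := hs.concat_b ih (by
        rw [hca, hcb]; push_cast
        linarith [not_lt.1 h2])
      simpa [subst_append, subst] using h3

theorem IsCharacteristicSturmian.exists_desubst {s : InfWord} (hs : IsCharacteristicSturmian s) :
    ∃ (x : Letter) (t : InfWord), IsCharacteristicSturmian t ∧
      ∀ n, IsPrefixOf (subst x (pre t n) ++ [x]) s := by
  obtain ⟨α, h0, hirr, hcut⟩ := hs
  rcases lt_trichotomy α 1 with h | h | h
  · have hpos : 0 < 1 - α := by linarith
    obtain ⟨t, ht⟩ := exists_isCuttingSequence (α / (1 - α))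
    refine ⟨Letter.a, t, ⟨_, by positivity, ?_, ht⟩,
      hcut.desubst_of_lt_one h0 h (by field_simp) ht⟩
    have : Irrational (α⁻¹ - 1) := by simpa using (irrational_inv_iff.2 hirr).sub_intCast 1
    have h2 := irrational_inv_iff.2 this
    rwa [show (α⁻¹ - 1)⁻¹ = α / (1 - α) by field_simp] at h2
  · exact absurd h hirr.ne_one
  · obtain ⟨t, ht⟩ := exists_isCuttingSequence (α - 1)
    exact ⟨Letter.b, t, ⟨_, by linarith, by simpa using hirr.sub_intCast 1, ht⟩,
      hcut.desubst_of_one_lt h ht⟩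

/-- Every characteristic Sturmian word has a directive word. -/
theorem IsCharacteristicSturmian.exists_eq_psiInf {s : InfWord}
    (hs : IsCharacteristicSturmian s) : ∃ x, s = psiInf x := by
  choose l d hd hpre using fun s : {s // IsCharacteristicSturmian s} => s.2.exists_desubst
  let D : {s // IsCharacteristicSturmian s} → {s // IsCharacteristicSturmian s} :=
    fun s => ⟨d s, hd s⟩
  -- The directive word lists the letters met when desubstitution is iterated. The induction runs
  -- over all `s` at once because its tail belongs to `D s`.
  have key : ∀ n (s : {s // IsCharacteristicSturmian s}),
      IsPrefixOf (psi (pre (fun i => l (D^[i] s)) n)) s.1 := by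
    intro n
    induction n with
    | zero => exact fun s => rfl
    | succ n ih =>
      intro s
      have h1 : pre (fun i => l (D^[i] s)) (n + 1) =
          l s :: pre (fun i => l (D^[i] (D s))) n := by
        rw [add_comm, pre_add]
        simp only [add_comm 1, Function.iterate_succ, Function.comp_apply]
        rfl
      rw [h1, psi_cons]
      have h2 := hpre s (psi (pre (fun i => l (D^[i] (D s))) n)).length
      rwa [show pre (d s) _ = _ from ih (D s)] at h2
  exact ⟨_, eq_psiInf (key · ⟨s, hs⟩)⟩

/-! ### Alternating directive words -/

theorem isChain_pre {x : InfWord} (h : ∀ k, x k ≠ x (k + 1)) (n : ℕ) :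
    (pre x n).IsChain (· ≠ ·) := by
  rw [isChain_iff_getElem]
  intro i hi
  simpa [pre] using h i

theorem alternating_eq {x y : InfWord} (hx : ∀ k, x k ≠ x (k + 1)) (hy : ∀ k, y k ≠ y (k + 1))
    (h : x 0 = y 0) : x = y := by
  funext k
  induction k with
  | zero => exact h
  | succ k ih => rw [Letter.ne_iff.1 (hx k), Letter.ne_iff.1 (hy k), ih]

/-- The directive word `(ab)^ω` of the Fibonacci word. -/
def fibDirective : InfWord := fun i => if Even i then Letter.a else Letter.b

theorem fib_eq : fib = psiInf fibDirective := rfl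

theorem fibDirective_alternating (k : ℕ) : fibDirective k ≠ fibDirective (k + 1) := by
  by_cases h : Even k <;> simp [fibDirective, h, Nat.even_add_one]

theorem E_alternating {x : InfWord} (h : ∀ k, x k ≠ x (k + 1)) (k : ℕ) :
    E x k ≠ E x (k + 1) := by
  intro he
  have := congrArg Letter.swap he
  simp only [E, Letter.swap_swap] at this
  exact h k this

/-- The directive word of a central prefix is forced to be a prefix of `x`, hence alternates and
attains the Fibonacci bound. -/
theorem minPeriod_le_of_alternating {x : InfWord} (hx : ∀ k, x k ≠ x (k + 1)) {n : ℕ} {w u : Word}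
    (hw : IsPalPrefixOfOrder (psiInf x) n w) (hu : IsCentralOfOrder n u) :
    minPeriod u ≤ minPeriod w := by
  obtain ⟨hpre, -, v, rfl, rfl⟩ := hw
  obtain ⟨v', hv', rfl⟩ := hu
  have hv : v.IsChain (· ≠ ·) := by
    rw [eq_pre_of_isPrefixOf_psiInf hpre]
    exact isChain_pre hx _
  rw [minPeriod_psi, minPeriod_psi, centralPeriod_eq_fib_of_alternating v hv, ← hv']
  exact (centralPeriod_le_fib v').1

theorem palindrome_psi (v : Word) : (psi v).Palindrome := by
  induction v using List.reverseRecOn with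
  | nil => exact Palindrome.nil
  | append_singleton v y _ => rw [psi_concat]; exact palindrome_palClosure _

theorem alternating_of_minPeriod_maximal {x : InfWord}
    (h : ∀ (n : ℕ) (w : Word), IsPalPrefixOfOrder (psiInf x) n w →
      ∀ u : Word, IsCentralOfOrder n u → minPeriod u ≤ minPeriod w) (k : ℕ) :
    x k ≠ x (k + 1) := by
  -- Order `k + 4` leaves two letters after positions `k` and `k + 1`; the Fibonacci directive word
  -- provides a competitor attaining the bound.
  have h1 := h (k + 4) (psi (pre x (k + 4)))
    ⟨psi_pre_isPrefixOf_psiInf _ _, palindrome_psi _, _, length_pre _ _, rfl⟩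
    (psi (pre fibDirective (k + 4))) ⟨_, length_pre _ _, rfl⟩
  rw [minPeriod_psi, minPeriod_psi,
    centralPeriod_eq_fib_of_alternating _ (isChain_pre fibDirective_alternating _),
    length_pre] at h1
  have h2 := (centralPeriod_le_fib (pre x (k + 4))).1
  rw [length_pre] at h2
  have h3 : pre x (k + 4) = pre x k ++ x k :: x (k + 1) :: [x (k + 2), x (k + 3)] := by
    rw [pre_add]; rfl
  refine ne_of_centralPeriod_eq_fib (u := pre x k) (v := [x (k + 2), x (k + 3)]) rfl ?_
  rw [← h3, length_pre]
  exact le_antisymm h2 h1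

end SturmianWords

open SturmianWords in
theorem theorem4p6 (s : InfWord) (hs : IsCharacteristicSturmian s) :
    (∀ (n : ℕ) (w : Word), IsPalPrefixOfOrder s n w →
        ∀ u : Word, IsCentralOfOrder n u → minPeriod u ≤ minPeriod w) ↔
      (s = fib ∨ s = E fib) := by
  constructor
  · intro h
    obtain ⟨x, rfl⟩ := hs.exists_eq_psiInf
    have hx := alternating_of_minPeriod_maximal h
    rw [fib_eq, E_psiInf]
    by_cases h0 : x 0 = fibDirective 0
    · exact Or.inl (congrArg _ (alternating_eq hx fibDirective_alternating h0))
    · refine Or.inr (congrArg _ (alternating_eq hx (E_alternating fibDirective_alternating) ?_))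
      exact Letter.ne_iff.1 (Ne.symm h0)
  · rintro (rfl | rfl) n w hw u hu
    · exact minPeriod_le_of_alternating fibDirective_alternating hw hu
    · rw [fib_eq, E_psiInf] at hw
      exact minPeriod_le_of_alternating (E_alternating fibDirective_alternating) hw hu
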